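/- Let $\nabla_1$ and $\nabla_2$ be complete Boolean algebras, and let $\mu$ on $\nabla_1$ and $\nu$ on $\nabla_2$ be strictly positive, countably additive, $\sigma$-finite measures with values in $[0,\infty]$. For a complete Boolean algebra $\nabla$ let $\mathcal L_0(\nabla)$ be the $*$-algebra of complex measurable functions of $\nabla$: the Borel functions from the Stone space $\Omega$ of $\nabla$ to $\mathbb C$, with the pointwise operations, two functions being identified when they agree outside a meagre set. A strictly positive, countably additive, $\sigma$-finite measure $\mu$ on $\nabla$ induces the Borel measure on $\Omega$ that gives the value $\mu(e)$ to every Borel set differing by a meagre set from the clopen set representing $e\in\nabla$; integrals with respect to $\mu$ are taken with respect to it. Put $$\mathcal L_{\log}(\nabla,\mu)=\Big\{f\in\mathcal L_0(\nabla):\ \int_\Omega\log(1+|f|)\,d\mu<\infty\Big\},$$ a (possibly non-unital) $*$-subalgebra of $\mathcal L_0(\nabla)$. The measures $\mu$ and $\nu$ are called log-equivalent if there is an isomorphism of Boolean algebras $\varphi:\nabla_1\to\nabla_2$ such that $\mathcal L_{\log}(\nabla_2,\nu)=\mathcal L_{\log}(\nabla_2,\mu\circ\varphi^{-1})$ as subsets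 of $\mathcal L_0(\nabla_2)$, where $(\mu\circ\varphi^{-1})(e)=\mu(\varphi^{-1}(e))$ for $e\in\nabla_2$. **Theorem.** The $*$-algebras $\mathcal L_{\log}(\nabla_1,\mu)$ and $\mathcal L_{\log}(\nabla_2,\nu)$ are $*$-isomorphic (as complex $*$-algebras) if and only if the measures $\mu$ and $\nu$ are log-equivalent. -/

import Mathlib

open MeasureTheory Set Filter Topology
open scoped ENNReal

noncomputable section

namespace LogAlgebra

/-! ### Measures on complete Boolean algebras -/

/-- A strictly positive, countably additive, σ-finite measure on a complete Boolean algebra `B`. -/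
structure BooleanMeasure (B : Type*) [CompleteBooleanAlgebra B] where
  /-- the value of the measure on an element of the algebra -/
  toFun : B → ℝ≥0∞
  map_bot : toFun ⊥ = 0
  strictly_positive : ∀ e, toFun e = 0 → e = ⊥
  countably_additive : ∀ e : ℕ → B, Pairwise (fun i j => Disjoint (e i) (e j)) →
    toFun (⨆ n, e n) = ∑' n, toFun (e n)
  sigma_finite : ∃ e : ℕ → B, (⨆ n, e n) = ⊤ ∧ ∀ n, toFun (e n) < ∞

instance {B : Type*} [CompleteBooleanAlgebra B] : CoeFun (BooleanMeasure B) fun _ => B → ℝ≥0∞ :=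
  ⟨BooleanMeasure.toFun⟩

/-- The transport of a measure `μ` along an isomorphism `φ : B₁ → B₂` of Boolean algebras: it is
the measure on `B₂` whose value at `φ e` is `μ e`. (An order isomorphism of Boolean algebras is the
same thing as an isomorphism of Boolean algebras.) -/
def BooleanMeasure.map {B₁ B₂ : Type*} [CompleteBooleanAlgebra B₁] [CompleteBooleanAlgebra B₂]
    (μ : BooleanMeasure B₁) (φ : B₁ ≃o B₂) : BooleanMeasure B₂ where
  toFun e := μ (φ.symm e)
  map_bot := by rw [φ.symm.map_bot, μ.map_bot]
  strictly_positive e h := by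
    have := μ.strictly_positive _ h
    rwa [← φ.symm.map_bot, φ.symm.injective.eq_iff] at this
  countably_additive e he := by
    rw [φ.symm.map_iSup]
    exact μ.countably_additive _ fun i j hij => (disjoint_map_orderIso_iff φ.symm).2 (he hij)
  sigma_finite := by
    obtain ⟨e, he, hf⟩ := μ.sigma_finite
    refine ⟨fun n => φ (e n), ?_, fun n => by simpa using hf n⟩
    rw [← φ.map_iSup, he, φ.map_top]

/-! ### The Stone space -/

/-- The Stone space of a Boolean algebra: the two-valued homomorphisms (equivalently, the
ultrafilters of the algebra). -/
def StoneSpace (B : Type*) [CompleteBooleanAlgebra B] : Type _ := BoundedLatticeHom B Bool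

namespace StoneSpace

variable {B : Type*} [CompleteBooleanAlgebra B]

/-- The evaluation of a point of the Stone space. -/
def eval (x : StoneSpace B) (e : B) : Bool := BoundedLatticeHom.toLatticeHom x e

/-- The topology of pointwise convergence; its basic open sets are the sets `basicClopen e`. -/
instance : TopologicalSpace (StoneSpace B) := TopologicalSpace.induced eval inferInstance

instance : MeasurableSpace (StoneSpace B) := borel _

instance : BorelSpace (StoneSpace B) := ⟨rfl⟩

/-- The clopen subset of the Stone space represented by an element of the algebra. -/
def basicClopen (e : B) : Set (StoneSpace B) := {x | x.eval e = true}

theorem eval_inf (x : StoneSpace B) (a b : B) : x.eval (a ⊓ b) = (x.eval a && x.eval b) :=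
  map_inf (BoundedLatticeHom.toLatticeHom x) a b

theorem eval_sup (x : StoneSpace B) (a b : B) : x.eval (a ⊔ b) = (x.eval a || x.eval b) :=
  map_sup (BoundedLatticeHom.toLatticeHom x) a b

theorem eval_bot (x : StoneSpace B) : x.eval ⊥ = false := BoundedLatticeHom.map_bot' x

theorem eval_top (x : StoneSpace B) : x.eval ⊤ = true := BoundedLatticeHom.map_top' x

theorem eval_injective : Function.Injective (eval : StoneSpace B → B → Bool) := by
  intro x y h
  exact DFunLike.ext (F := BoundedLatticeHom B Bool) x y fun e => congrFun h e

theorem continuous_eval : Continuous (eval : StoneSpace B → B → Bool) := continuous_induced_dom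

theorem isClosed_range_eval : IsClosed (range (eval : StoneSpace B → B → Bool)) := by
  have : range (eval : StoneSpace B → B → Bool) =
      {f | ((∀ a b, f (a ⊓ b) = (f a && f b)) ∧ ∀ a b, f (a ⊔ b) = (f a || f b)) ∧
        f ⊥ = false ∧ f ⊤ = true} := by
    ext f
    constructor
    · rintro ⟨x, rfl⟩
      exact ⟨⟨x.eval_inf, x.eval_sup⟩, x.eval_bot, x.eval_top⟩
    · rintro ⟨⟨h1, h2⟩, h3, h4⟩
      exact ⟨(⟨⟨⟨f, h2⟩, h1⟩, h4, h3⟩ : BoundedLatticeHom B Bool), rfl⟩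
  rw [this]
  have c2 : Continuous fun p : Bool × Bool => (p.1 && p.2) := continuous_of_discreteTopology
  have c3 : Continuous fun p : Bool × Bool => (p.1 || p.2) := continuous_of_discreteTopology
  have h : ∀ a b : B, Continuous fun f : B → Bool => (f a, f b) := fun a b =>
    (continuous_apply a).prodMk (continuous_apply b)
  have k1 : ∀ a b : B, IsClosed {f : B → Bool | f (a ⊓ b) = (f a && f b)} := fun a b =>
    isClosed_eq (continuous_apply _) (c2.comp (h a b))
  have k2 : ∀ a b : B, IsClosed {f : B → Bool | f (a ⊔ b) = (f a || f b)} := fun a b =>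
    isClosed_eq (continuous_apply _) (c3.comp (h a b))
  have k3 : IsClosed {f : B → Bool | f ⊥ = false} := isClosed_eq (continuous_apply _)
    continuous_const
  have k4 : IsClosed {f : B → Bool | f ⊤ = true} := isClosed_eq (continuous_apply _)
    continuous_const
  have k := ((isClosed_iInter fun a => isClosed_iInter (k1 a)).inter
    (isClosed_iInter fun a => isClosed_iInter (k2 a))).inter (k3.inter k4)
  convert k using 1
  ext f
  simp

theorem isClosedEmbedding_eval : IsClosedEmbedding (eval : StoneSpace B → B → Bool) :=
  ⟨⟨⟨rfl⟩, eval_injective⟩, isClosed_range_eval⟩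

instance : CompactSpace (StoneSpace B) := isClosedEmbedding_eval.compactSpace

instance : T2Space (StoneSpace B) := isClosedEmbedding_eval.isEmbedding.t2Space

theorem isClopen_basicClopen (e : B) : IsClopen (basicClopen e) :=
  (isClopen_discrete {true}).preimage ((continuous_apply e).comp continuous_eval)

theorem mem_basicClopen {x : StoneSpace B} {e : B} : x ∈ basicClopen e ↔ x.eval e = true := Iff.rfl

theorem basicClopen_inf (a b : B) : basicClopen (a ⊓ b) = basicClopen a ∩ basicClopen b := by
  ext x; simp [mem_basicClopen, eval_inf]

theorem basicClopen_bot : basicClopen (⊥ : B) = ∅ := by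
  ext x; simp [mem_basicClopen, eval_bot]

theorem basicClopen_top : basicClopen (⊤ : B) = univ := by
  ext x; simp [mem_basicClopen, eval_top]

theorem basicClopen_compl (a : B) : basicClopen aᶜ = (basicClopen a)ᶜ := by
  ext x
  have h1 := x.eval_inf a aᶜ
  have h2 := x.eval_sup a aᶜ
  rw [inf_compl_eq_bot, eval_bot] at h1
  rw [sup_compl_eq_top, eval_top] at h2
  simp only [mem_basicClopen, mem_compl_iff]
  revert h1 h2
  cases x.eval a <;> cases x.eval aᶜ <;> simp

theorem basicClopen_mono {a b : B} (h : a ≤ b) : basicClopen a ⊆ basicClopen b := by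
  rw [← inf_eq_left.2 h, basicClopen_inf]
  exact inter_subset_right

theorem basicClopen_nonempty {e : B} (he : e ≠ ⊥) : (basicClopen e).Nonempty := by
  obtain ⟨J, hJ, -, hd⟩ := DistribLattice.prime_ideal_of_disjoint_filter_ideal
    (F := Order.PFilter.principal e) (I := Order.Ideal.principal (⊥ : B)) (by
      rw [Set.disjoint_left]
      intro a ha hb
      have ha' : e ≤ a := ha
      have hb' : a ≤ ⊥ := hb
      exact he (le_bot_iff.1 (ha'.trans hb')))
  have heJ : e ∉ J := fun h => Set.disjoint_left.1 hd (show e ∈ Order.PFilter.principal e from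
    le_refl e) h
  classical
  refine ⟨(⟨⟨⟨fun a => decide (a ∉ J), fun a b => ?_⟩, fun a b => ?_⟩, ?_, ?_⟩ :
    BoundedLatticeHom B Bool), decide_eq_true heJ⟩
  · have : a ⊔ b ∈ J ↔ a ∈ J ∧ b ∈ J := Order.Ideal.sup_mem_iff
    by_cases h1 : a ∈ J <;> by_cases h2 : b ∈ J <;> simp [this, h1, h2]
  · have : a ⊓ b ∈ J ↔ a ∈ J ∨ b ∈ J :=
      ⟨hJ.mem_or_mem, fun h => h.elim (J.lower inf_le_left) (J.lower inf_le_right)⟩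
    by_cases h1 : a ∈ J <;> by_cases h2 : b ∈ J <;> simp [this, h1, h2]
  · have : (⊤ : B) ∉ J := fun h => heJ (J.lower le_top h)
    simpa using this
  · simp

/-- The sets `basicClopen e` form a basis of the topology. -/
theorem exists_basicClopen_subset {U : Set (StoneSpace B)} (hU : IsOpen U) {x : StoneSpace B}
    (hx : x ∈ U) : ∃ e : B, x ∈ basicClopen e ∧ basicClopen e ⊆ U := by
  obtain ⟨V, hV, rfl⟩ := isOpen_induced_iff.1 hU
  obtain ⟨I, u, hu, hIu⟩ := isOpen_pi_iff.1 hV _ hx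
  let g : B → B := fun a => if x.eval a = true then a else aᶜ
  have hg : ∀ a, x ∈ basicClopen (g a) := fun a => by
    by_cases h : x.eval a = true
    · simpa [g, h] using mem_basicClopen.2 h
    · simp only [g, h]
      rw [if_neg (by simp), basicClopen_compl]
      exact h
  have hg' : ∀ a (y : StoneSpace B), y ∈ basicClopen (g a) → y.eval a = x.eval a := fun a y hy => by
    by_cases h : x.eval a = true
    · simp only [g, h] at hy
      rw [h]; exact mem_basicClopen.1 (by simpa using hy)
    · simp only [g, h] at hy
      rw [if_neg (by simp), basicClopen_compl] at hy
      have hy' : ¬ y.eval a = true := hy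
      simp only [Bool.not_eq_true] at h hy'
      rw [h, hy']
  have key : ∀ (s : Finset B) (y : StoneSpace B),
      y ∈ basicClopen (s.inf g) ↔ ∀ a ∈ s, y ∈ basicClopen (g a) := by
    intro s y
    classical
    induction s using Finset.induction_on with
    | empty => simp [basicClopen_top]
    | insert a s _ ih => simp [Finset.inf_insert, basicClopen_inf, ih]
  refine ⟨I.inf g, (key _ _).2 fun a _ => hg a, fun y hy => hIu fun a ha => ?_⟩
  rw [hg' a y ((key _ _).1 hy a ha)]
  exact (hu a ha).2

theorem basicClopen_subset_iff {a b : B} : basicClopen a ⊆ basicClopen b ↔ a ≤ b := by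
  refine ⟨fun h => ?_, basicClopen_mono⟩
  by_contra hab
  have hne : a ⊓ bᶜ ≠ ⊥ := fun h0 => hab (by rwa [← disjoint_iff, disjoint_compl_right_iff] at h0)
  obtain ⟨x, hx⟩ := basicClopen_nonempty hne
  rw [basicClopen_inf, basicClopen_compl] at hx
  exact hx.2 (h hx.1)

/-- The closure of an open set is the clopen set of the supremum of the elements below it. -/
theorem closure_eq_basicClopen {U : Set (StoneSpace B)} (hU : IsOpen U) :
    closure U = basicClopen (sSup {e : B | basicClopen e ⊆ U}) := by
  apply Subset.antisymm
  · refine closure_minimal (fun x hx => ?_) (isClopen_basicClopen _).1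
    obtain ⟨e, hxe, he⟩ := exists_basicClopen_subset hU hx
    exact basicClopen_mono (le_sSup (show e ∈ {e : B | basicClopen e ⊆ U} from he)) hxe
  · intro x hx
    by_contra hxU
    obtain ⟨d, hxd, hd⟩ := exists_basicClopen_subset isClosed_closure.isOpen_compl hxU
    have : sSup {e : B | basicClopen e ⊆ U} ≤ dᶜ := by
      refine sSup_le fun e he => basicClopen_subset_iff.1 ?_
      rw [basicClopen_compl]
      exact fun y hy hyd => hd hyd (subset_closure (he hy))
    have h2 := basicClopen_mono this hx
    rw [basicClopen_compl] at h2
    exact h2 hxd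

theorem basicClopen_iSup (e : ℕ → B) :
    basicClopen (⨆ n, e n) = closure (⋃ n, basicClopen (e n)) := by
  have ho : IsOpen (⋃ n, basicClopen (e n)) := isOpen_iUnion fun n => (isClopen_basicClopen _).2
  apply Subset.antisymm
  · rw [closure_eq_basicClopen ho]
    exact basicClopen_mono (iSup_le fun n => le_sSup (subset_iUnion (fun n => basicClopen (e n)) n))
  · exact closure_minimal (iUnion_subset fun n => basicClopen_mono (le_iSup e n))
      (isClopen_basicClopen _).1

/-- The element of the algebra represented by a Borel subset of the Stone space: the largest `e`
whose clopen set is contained in `S` up to a meagre set. -/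
def value (S : Set (StoneSpace B)) : B := sSup {e : B | IsMeagre (basicClopen e \ S)}

theorem le_of_isMeagre_diff {a b : B} (h : IsMeagre (basicClopen a \ basicClopen b)) : a ≤ b := by
  by_contra hab
  refine not_isMeagre_of_isOpen ((isClopen_basicClopen a).2.sdiff (isClopen_basicClopen b).1) ?_ h
  rw [sdiff_nonempty]
  exact fun hs => hab (basicClopen_subset_iff.1 hs)

theorem value_eq {S : Set (StoneSpace B)} {e : B} (h : S =ᶠ[residual _] basicClopen e) :
    value S = e := by
  have key : ∀ a : B, IsMeagre (basicClopen a \ S) ↔ a ≤ e := by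
    intro a
    have h1 : IsMeagre (basicClopen a \ S) ↔ IsMeagre (basicClopen a \ basicClopen e) := by
      unfold IsMeagre
      refine Filter.congr_sets ?_
      filter_upwards [h.mem_iff] with x hx
      simp [hx]
    refine h1.trans ⟨le_of_isMeagre_diff, fun hle => ?_⟩
    rw [sdiff_eq_empty.2 (basicClopen_mono hle)]
    exact IsMeagre.empty
  simp only [value, key]
  exact csSup_Iic

/-- Every Borel subset of the Stone space agrees with a clopen set up to a meagre set. -/
theorem eventuallyEq_value {S : Set (StoneSpace B)} (hS : MeasurableSet S) :
    S =ᶠ[residual _] basicClopen (value S) := by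
  obtain ⟨U, hU, hSU⟩ := hS.residualEq_isOpen
  have h : S =ᶠ[residual _] basicClopen (sSup {e : B | basicClopen e ⊆ U}) := by
    rw [← closure_eq_basicClopen hU]
    exact hSU.trans (closure_residualEq hU.isLocallyClosed).symm
  rwa [value_eq h]

theorem value_iUnion {S : ℕ → Set (StoneSpace B)} (hS : ∀ n, MeasurableSet (S n)) :
    value (⋃ n, S n) = ⨆ n, value (S n) := by
  apply value_eq
  rw [basicClopen_iSup]
  refine (Filter.EventuallyEq.countable_iUnion fun n => eventuallyEq_value (hS n)).trans ?_
  exact (closure_residualEq (isOpen_iUnion fun n =>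
    (isClopen_basicClopen _).2).isLocallyClosed).symm

theorem disjoint_value {S T : Set (StoneSpace B)} (hS : MeasurableSet S) (hT : MeasurableSet T)
    (h : Disjoint S T) : Disjoint (value S) (value T) := by
  have h0 : (∅ : Set (StoneSpace B)) =ᶠ[residual _] basicClopen (value S ⊓ value T) := by
    rw [basicClopen_inf, ← h.inter_eq]
    exact (eventuallyEq_value hS).inter (eventuallyEq_value hT)
  have h1 : (∅ : Set (StoneSpace B)) =ᶠ[residual _] basicClopen (⊥ : B) := by
    rw [basicClopen_bot]; exact EventuallyEq.rfl
  rw [disjoint_iff, ← value_eq h0, value_eq h1]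

end StoneSpace

open StoneSpace

/-! ### The algebra of measurable functions -/

instance instStarGerm {X R : Type*} {l : Filter X} [Star R] : Star (l.Germ R) := ⟨Germ.map star⟩

theorem germ_coe_star {X R : Type*} {l : Filter X} [Star R] (f : X → R) :
    ((star f : X → R) : l.Germ R) = star (f : l.Germ R) := rfl

instance instStarRingGerm {X R : Type*} {l : Filter X} [CommRing R] [StarRing R] :
    StarRing (l.Germ R) where
  star_involutive f := by
    induction f using Germ.inductionOn with | _ f => ?_
    rw [← germ_coe_star, ← germ_coe_star, star_star]
  star_mul f g := by
    induction f using Germ.inductionOn with | _ f => ?_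
    induction g using Germ.inductionOn with | _ g => ?_
    rw [← Germ.coe_mul, ← germ_coe_star, ← germ_coe_star, ← germ_coe_star, ← Germ.coe_mul, star_mul]
  star_add f g := by
    induction f using Germ.inductionOn with | _ f => ?_
    induction g using Germ.inductionOn with | _ g => ?_
    rw [← Germ.coe_add, ← germ_coe_star, ← germ_coe_star, ← germ_coe_star, ← Germ.coe_add, star_add]

instance instAlgebraGerm {X R : Type*} {l : Filter X} [CommRing R] : Algebra R (l.Germ R) :=
  Algebra.ofModule
    (fun r f g => by
      induction f using Germ.inductionOn with | _ f => ?_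
      induction g using Germ.inductionOn with | _ g => ?_
      rw [← Germ.coe_smul, ← Germ.coe_mul, ← Germ.coe_mul, ← Germ.coe_smul, smul_mul_assoc])
    (fun r f g => by
      induction f using Germ.inductionOn with | _ f => ?_
      induction g using Germ.inductionOn with | _ g => ?_
      rw [← Germ.coe_smul, ← Germ.coe_mul, ← Germ.coe_mul, ← Germ.coe_smul, mul_smul_comm])

instance instStarModuleGerm {X R : Type*} {l : Filter X} [CommRing R] [StarRing R] :
    StarModule R (l.Germ R) where
  star_smul r f := by
    induction f using Germ.inductionOn with | _ f => ?_
    rw [← Germ.coe_smul, ← germ_coe_star, ← germ_coe_star, ← Germ.coe_smul, star_smul]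

/-- The `*`-algebra `L₀(B)` of complex measurable functions of a complete Boolean algebra `B`:
Borel functions on the Stone space of `B`, two functions being identified when they agree off a
meagre set, with the pointwise operations. (Borel sets modulo meagre sets form the algebra `B`.) -/
def L0 (B : Type*) [CompleteBooleanAlgebra B] :
    StarSubalgebra ℂ ((residual (StoneSpace B)).Germ ℂ) where
  carrier := {f | ∃ g : StoneSpace B → ℂ, Measurable g ∧ (g : (residual (StoneSpace B)).Germ ℂ) = f}
  mul_mem' := by
    rintro _ _ ⟨f, hf, rfl⟩ ⟨g, hg, rfl⟩
    exact ⟨f * g, hf.mul hg, rfl⟩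
  add_mem' := by
    rintro _ _ ⟨f, hf, rfl⟩ ⟨g, hg, rfl⟩
    exact ⟨f + g, hf.add hg, rfl⟩
  algebraMap_mem' c := by
    refine ⟨c • (1 : StoneSpace B → ℂ), measurable_const.const_smul c, ?_⟩
    rw [Algebra.algebraMap_eq_smul_one]
    rfl
  star_mem' := by
    rintro _ ⟨f, hf, rfl⟩
    exact ⟨star f, continuous_star.measurable.comp hf, rfl⟩

/-! ### Integration and log-integrable functions -/

/-- The Borel measure on the Stone space induced by a measure on the Boolean algebra: a Borel set
that agrees with the clopen set of `e` up to a meagre set has measure `μ e`. -/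
def BooleanMeasure.stoneMeasure {B : Type*} [CompleteBooleanAlgebra B] (μ : BooleanMeasure B) :
    Measure (StoneSpace B) :=
  Measure.ofMeasurable (fun S _ => μ (value S))
    (by
      have h : (∅ : Set (StoneSpace B)) =ᶠ[residual _] basicClopen (⊥ : B) := by
        rw [basicClopen_bot]; exact EventuallyEq.rfl
      simp only [value_eq h, μ.map_bot])
    (fun S hS hd => by
      simp only [value_iUnion hS]
      exact μ.countably_additive _ fun i j hij => disjoint_value (hS i) (hS j) (hd hij))

theorem BooleanMeasure.stoneMeasure_apply {B : Type*} [CompleteBooleanAlgebra B]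
    (μ : BooleanMeasure B) {S : Set (StoneSpace B)} (hS : MeasurableSet S) :
    μ.stoneMeasure S = μ (value S) :=
  Measure.ofMeasurable_apply S hS

theorem BooleanMeasure.stoneMeasure_basicClopen {B : Type*} [CompleteBooleanAlgebra B]
    (μ : BooleanMeasure B) (e : B) : μ.stoneMeasure (basicClopen e) = μ e := by
  rw [μ.stoneMeasure_apply (isClopen_basicClopen e).1.measurableSet, value_eq EventuallyEq.rfl]

theorem BooleanMeasure.stoneMeasure_eq_zero_iff {B : Type*} [CompleteBooleanAlgebra B]
    (μ : BooleanMeasure B) {S : Set (StoneSpace B)} (hS : MeasurableSet S) :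
    μ.stoneMeasure S = 0 ↔ IsMeagre S := by
  have hv := eventuallyEq_value hS
  have hm : IsMeagre S ↔ S =ᶠ[residual _] (∅ : Set (StoneSpace B)) := by
    rw [eventuallyEq_empty]; rfl
  rw [μ.stoneMeasure_apply hS, hm]
  constructor
  · intro h
    rwa [μ.strictly_positive _ h, basicClopen_bot] at hv
  · intro h
    rw [← basicClopen_bot] at h
    rw [value_eq h, μ.map_bot]

/-- The value of `∫ log (1 + |f|) dμ`, in `[0, ∞]`, for a function `f` on the Stone space. -/
def logIntegral {B : Type*} [CompleteBooleanAlgebra B] (μ : BooleanMeasure B)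
    (f : StoneSpace B → ℂ) : ℝ≥0∞ :=
  ∫⁻ x, ENNReal.ofReal (Real.log (1 + ‖f x‖)) ∂μ.stoneMeasure

theorem logIntegral_congr {B : Type*} [CompleteBooleanAlgebra B] (μ : BooleanMeasure B)
    {f g : StoneSpace B → ℂ} (hf : Measurable f) (hg : Measurable g)
    (h : f =ᶠ[residual _] g) : logIntegral μ f = logIntegral μ g := by
  have hn : μ.stoneMeasure {x | f x = g x}ᶜ = 0 := by
    rw [μ.stoneMeasure_eq_zero_iff (measurableSet_eq_fun hf hg).compl, IsMeagre, compl_compl]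
    exact h
  refine lintegral_congr_ae ?_
  filter_upwards [show ∀ᵐ x ∂μ.stoneMeasure, f x = g x from hn] with x hx
  rw [hx]

theorem log_one_add_le {s t u : ℝ} (hs : 0 ≤ s) (ht : 0 ≤ t) (hu : 0 ≤ u)
    (h : 1 + u ≤ (1 + s) * (1 + t)) :
    ENNReal.ofReal (Real.log (1 + u)) ≤
      ENNReal.ofReal (Real.log (1 + s)) + ENNReal.ofReal (Real.log (1 + t)) := by
  rw [← ENNReal.ofReal_add (Real.log_nonneg (by linarith)) (Real.log_nonneg (by linarith)),
    ← Real.log_mul (by linarith) (by linarith)]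
  exact ENNReal.ofReal_le_ofReal (Real.log_le_log (by linarith) h)

theorem logIntegral_le_add {B : Type*} [CompleteBooleanAlgebra B] (μ : BooleanMeasure B)
    {f g h : StoneSpace B → ℂ} (hf : Measurable f)
    (hle : ∀ x, 1 + ‖h x‖ ≤ (1 + ‖f x‖) * (1 + ‖g x‖)) :
    logIntegral μ h ≤ logIntegral μ f + logIntegral μ g := by
  have hm : Measurable fun x => ENNReal.ofReal (Real.log (1 + ‖f x‖)) :=
    (Real.measurable_log.comp (measurable_const.add hf.norm)).ennreal_ofReal
  unfold logIntegral
  rw [← lintegral_add_left hm]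
  exact lintegral_mono fun x =>
    log_one_add_le (norm_nonneg _) (norm_nonneg _) (norm_nonneg _) (hle x)

theorem logIntegral_smul_lt_top {B : Type*} [CompleteBooleanAlgebra B] (μ : BooleanMeasure B)
    {f : StoneSpace B → ℂ} (c : ℂ) (hf : Measurable f) (h : logIntegral μ f < ∞) :
    logIntegral μ (c • f) < ∞ := by
  have key : ∀ n : ℕ, logIntegral μ (fun x => (n : ℂ) * f x) < ∞ := by
    intro n
    induction n with
    | zero => simp [logIntegral]
    | succ n ih =>
      refine (logIntegral_le_add μ (measurable_const.mul hf) fun x => ?_).trans_lt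
        (ENNReal.add_lt_top.2 ⟨ih, h⟩)
      have h1 : ‖((n + 1 : ℕ) : ℂ) * f x‖ ≤ ‖(n : ℂ) * f x‖ + ‖f x‖ := by
        push_cast
        rw [add_mul, one_mul]
        exact norm_add_le _ _
      change 1 + ‖((n + 1 : ℕ) : ℂ) * f x‖ ≤ (1 + ‖(n : ℂ) * f x‖) * (1 + ‖f x‖)
      nlinarith [norm_nonneg ((n : ℂ) * f x), norm_nonneg (f x),
        mul_nonneg (norm_nonneg ((n : ℂ) * f x)) (norm_nonneg (f x))]
  obtain ⟨n, hn⟩ := exists_nat_ge ‖c‖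
  refine lt_of_le_of_lt (lintegral_mono fun x => ?_) (key n)
  refine ENNReal.ofReal_le_ofReal (Real.log_le_log (by positivity) ?_)
  simp only [Pi.smul_apply, smul_eq_mul, norm_mul, Complex.norm_natCast]
  gcongr

/-- The `*`-subalgebra `L_log(B, μ) = {f ∈ L₀(B) : ∫ log (1 + |f|) dμ < ∞}` of `L₀(B)` (it does not
contain the unit when `μ` is infinite). The integral does not depend on the representative `g` of
`f`, by `logIntegral_congr`. -/
def Llog {B : Type*} [CompleteBooleanAlgebra B] (μ : BooleanMeasure B) :
    NonUnitalStarSubalgebra ℂ (L0 B) where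
  carrier := {f | ∃ g : StoneSpace B → ℂ, Measurable g ∧
    (g : (residual (StoneSpace B)).Germ ℂ) = f ∧ logIntegral μ g < ∞}
  zero_mem' := ⟨0, measurable_const, rfl, by simp [logIntegral]⟩
  add_mem' := by
    rintro ⟨_, _⟩ ⟨_, _⟩ ⟨f, hf, rfl, hf'⟩ ⟨g, hg, rfl, hg'⟩
    refine ⟨f + g, hf.add hg, rfl, (logIntegral_le_add μ hf fun x => ?_).trans_lt
      (ENNReal.add_lt_top.2 ⟨hf', hg'⟩)⟩
    have h1 : ‖(f + g) x‖ ≤ ‖f x‖ + ‖g x‖ := norm_add_le _ _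
    nlinarith [mul_nonneg (norm_nonneg (f x)) (norm_nonneg (g x))]
  mul_mem' := by
    rintro ⟨_, _⟩ ⟨_, _⟩ ⟨f, hf, rfl, hf'⟩ ⟨g, hg, rfl, hg'⟩
    refine ⟨f * g, hf.mul hg, rfl, (logIntegral_le_add μ hf fun x => ?_).trans_lt
      (ENNReal.add_lt_top.2 ⟨hf', hg'⟩)⟩
    have h1 : ‖(f * g) x‖ = ‖f x‖ * ‖g x‖ := norm_mul _ _
    nlinarith [norm_nonneg (f x), norm_nonneg (g x)]
  smul_mem' := by
    rintro c ⟨_, _⟩ ⟨f, hf, rfl, hf'⟩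
    exact ⟨c • f, hf.const_smul c, rfl, logIntegral_smul_lt_top μ c hf hf'⟩
  star_mem' := by
    rintro ⟨_, _⟩ ⟨f, hf, rfl, hf'⟩
    exact ⟨star f, continuous_star.measurable.comp hf, rfl, by simpa [logIntegral] using hf'⟩

/-- Two measures `μ` on `B₁` and `ν` on `B₂` are log-equivalent if, for some isomorphism
`φ : B₁ → B₂`, the measure `ν` and the transport of `μ` along `φ` have the same log-integrable
functions in `L₀(B₂)`. -/
def LogEquivalent {B₁ B₂ : Type*} [CompleteBooleanAlgebra B₁] [CompleteBooleanAlgebra B₂]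
    (μ : BooleanMeasure B₁) (ν : BooleanMeasure B₂) : Prop :=
  ∃ φ : B₁ ≃o B₂, Llog ν = Llog (μ.map φ)

end LogAlgebra

end

noncomputable section

namespace LogAlgebra

open StoneSpace

/-! ### The action of an isomorphism on Stone spaces -/

/-! An isomorphism `φ` of the Boolean algebras dualizes to a homeomorphism of Stone spaces that
preserves meagre sets and carries the measure of `μ.map φ` to that of `μ`. Composition with it is
therefore a `*`-isomorphism of `Llog μ` onto `Llog (μ.map φ)`, which settles one direction.

Conversely, let `Φ` be a `*`-isomorphism. The idempotents of `Llog μ` are the indicators of elements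
of finite measure, and their order is multiplicative, so `Φ` restricts to an order isomorphism
between the elements of finite measure. These form lower sets, dense by σ-finiteness, so it extends
to some `φ : B₁ ≃o B₂` (`exists_orderIso_extension`).

It remains to see that `Φ` is composition with the homeomorphism of `φ` (`map_mk_eventuallyEq`). No
continuity of `Φ` is needed: a bound `‖g - c‖ ≤ ε` on a piece of finite measure is an algebraic
identity involving a term `star w * w`, hence survives `Φ` (`norm_sub_le_of_map_proj`). Countably
many such bounds determine a function off a meagre set. -/

/-- Precomposition with a homomorphism, on Stone spaces. -/
def StoneSpace.comap {B₁ B₂ : Type*} [CompleteBooleanAlgebra B₁] [CompleteBooleanAlgebra B₂]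
    (φ : B₁ ≃o B₂) (x : StoneSpace B₂) : StoneSpace B₁ :=
  (⟨⟨⟨fun e => x.eval (φ e), fun a b => by rw [φ.map_sup, eval_sup]; rfl⟩,
    fun a b => by
      change x.eval (φ (a ⊓ b)) = (x.eval (φ a) && x.eval (φ b))
      rw [φ.map_inf, eval_inf]⟩, by
      change x.eval (φ ⊤) = ⊤
      rw [φ.map_top, eval_top]; rfl, by
      change x.eval (φ ⊥) = ⊥
      rw [φ.map_bot, eval_bot]; rfl⟩ : BoundedLatticeHom B₁ Bool)

section Homeomorph

variable {B₁ B₂ : Type*} [CompleteBooleanAlgebra B₁] [CompleteBooleanAlgebra B₂] (φ : B₁ ≃o B₂)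

theorem StoneSpace.eval_comap (x : StoneSpace B₂) (e : B₁) :
    (comap φ x).eval e = x.eval (φ e) := rfl

theorem StoneSpace.continuous_comap : Continuous (comap φ) :=
  continuous_induced_rng.2 (continuous_pi fun e => (continuous_apply (φ e)).comp continuous_eval)

/-- The homeomorphism of Stone spaces dual to an isomorphism of complete Boolean algebras. -/
def stoneHomeomorph : StoneSpace B₂ ≃ₜ StoneSpace B₁ where
  toFun := comap φ
  invFun := comap φ.symm
  left_inv x := eval_injective (funext fun e => by simp [eval_comap])
  right_inv x := eval_injective (funext fun e => by simp [eval_comap])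
  continuous_toFun := continuous_comap φ
  continuous_invFun := continuous_comap φ.symm

theorem stoneHomeomorph_mem_basicClopen {x : StoneSpace B₂} {e : B₁} :
    stoneHomeomorph φ x ∈ basicClopen e ↔ x ∈ basicClopen (φ e) := Iff.rfl

theorem tendsto_residual_homeomorph {X Y : Type*} [TopologicalSpace X] [TopologicalSpace Y]
    (h : X ≃ₜ Y) : Tendsto h (residual X) (residual Y) :=
  tendsto_residual_of_isOpenMap h.continuous h.isOpenMap

theorem value_preimage_stoneHomeomorph {S : Set (StoneSpace B₁)} (hS : MeasurableSet S) :
    value (stoneHomeomorph φ ⁻¹' S) = φ (value S) :=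
  value_eq ((tendsto_residual_homeomorph (stoneHomeomorph φ)).eventually (eventuallyEq_value hS))

theorem map_stoneMeasure (μ : BooleanMeasure B₁) :
    (μ.map φ).stoneMeasure.map (stoneHomeomorph φ) = μ.stoneMeasure := by
  ext S hS
  rw [Measure.map_apply (stoneHomeomorph φ).continuous.measurable hS,
    BooleanMeasure.stoneMeasure_apply _ ((stoneHomeomorph φ).continuous.measurable hS),
    BooleanMeasure.stoneMeasure_apply _ hS, value_preimage_stoneHomeomorph φ hS]
  change μ (φ.symm (φ _)) = _
  rw [φ.symm_apply_apply]

theorem logIntegral_comp_stoneHomeomorph (μ : BooleanMeasure B₁) {g : StoneSpace B₁ → ℂ}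
    (hg : Measurable g) : logIntegral (μ.map φ) (g ∘ stoneHomeomorph φ) = logIntegral μ g := by
  unfold logIntegral
  rw [← map_stoneMeasure φ μ, lintegral_map _ (stoneHomeomorph φ).continuous.measurable]
  · rfl
  · exact (Real.measurable_log.comp (measurable_const.add hg.norm)).ennreal_ofReal

end Homeomorph

/-! ### Representatives -/

section Representatives

variable {B : Type*} [CompleteBooleanAlgebra B] {μ : BooleanMeasure B}

/-- The element of `L_log` represented by a log-integrable function. -/
def Llog.mk (g : StoneSpace B → ℂ) (hg : Measurable g) (h : logIntegral μ g < ∞) : Llog μ :=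
  ⟨⟨(g : (residual (StoneSpace B)).Germ ℂ), g, hg, rfl⟩, g, hg, rfl, h⟩

/-- The germ along the residual filter underlying an element of `L_log`. -/
def Llog.germ (f : Llog μ) : (residual (StoneSpace B)).Germ ℂ := f.1.1

theorem Llog.germ_injective : Function.Injective (Llog.germ (μ := μ)) :=
  Subtype.val_injective.comp Subtype.val_injective

theorem Llog.germ_add (f g : Llog μ) : germ (f + g) = germ f + germ g := rfl

theorem Llog.germ_mul (f g : Llog μ) : germ (f * g) = germ f * germ g := rfl

theorem Llog.germ_smul (c : ℂ) (f : Llog μ) : germ (c • f) = c • germ f := rfl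

theorem Llog.germ_star (f : Llog μ) : germ (star f) = star (germ f) := rfl

theorem Llog.exists_rep (f : Llog μ) : ∃ g, ∃ hg : Measurable g, ∃ h : logIntegral μ g < ∞,
    f = Llog.mk g hg h := by
  obtain ⟨f, g, hg, hf, h⟩ := f
  exact ⟨g, hg, h, Subtype.ext (Subtype.ext hf.symm)⟩

theorem Llog.mk_eq_mk {g g' : StoneSpace B → ℂ} {hg : Measurable g} {hg' : Measurable g'}
    {h : logIntegral μ g < ∞} {h' : logIntegral μ g' < ∞} :
    Llog.mk g hg h = Llog.mk g' hg' h' ↔ g =ᶠ[residual _] g' :=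
  germ_injective.eq_iff.symm.trans Germ.coe_eq

theorem mem_Llog_coe {g : StoneSpace B → ℂ} (hg : Measurable g)
    (hL : (g : (residual (StoneSpace B)).Germ ℂ) ∈ L0 B) :
    (⟨(g : (residual (StoneSpace B)).Germ ℂ), hL⟩ : L0 B) ∈ Llog μ ↔ logIntegral μ g < ∞ := by
  constructor
  · rintro ⟨g', hg', he, h⟩
    rwa [← logIntegral_congr μ hg' hg (Germ.coe_eq.1 he)]
  · exact fun h => ⟨g, hg, rfl, h⟩

theorem BooleanMeasure.mono (μ : BooleanMeasure B) {a b : B} (h : a ≤ b) : μ a ≤ μ b := by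
  rw [← μ.stoneMeasure_basicClopen, ← μ.stoneMeasure_basicClopen]
  exact measure_mono (basicClopen_mono h)

/-- Supplies the square-root witness of `norm_sub_le_of_map_proj`: bounded functions carried by an
element of finite measure are always available in `Llog μ`. -/
theorem logIntegral_indicator_lt_top {e : B} (he : μ e < ∞) {g : StoneSpace B → ℂ} {C : ℝ}
    (hC : ∀ x, ‖g x‖ ≤ C) : logIntegral μ ((basicClopen e).indicator g) < ∞ := by
  have hm : MeasurableSet (basicClopen e) := (isClopen_basicClopen e).1.measurableSet
  calc logIntegral μ ((basicClopen e).indicator g)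
      ≤ ∫⁻ x, (basicClopen e).indicator (fun _ => ENNReal.ofReal (Real.log (1 + C))) x
          ∂μ.stoneMeasure := by
        refine lintegral_mono fun x => ?_
        by_cases hx : x ∈ basicClopen e
        · simp only [indicator_of_mem hx]
          have := norm_nonneg (g x)
          exact ENNReal.ofReal_le_ofReal (Real.log_le_log (by linarith) (by linarith [hC x]))
        · simp [indicator_of_notMem hx]
    _ = ENNReal.ofReal (Real.log (1 + C)) * μ e := by
        rw [lintegral_indicator_const hm, μ.stoneMeasure_basicClopen]
    _ < ∞ := ENNReal.mul_lt_top ENNReal.ofReal_lt_top he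

/-- The indicator function of the clopen set of an element of the algebra. -/
def clopenIndicator (e : B) : StoneSpace B → ℂ := (basicClopen e).indicator fun _ => 1

theorem measurable_clopenIndicator (e : B) : Measurable (clopenIndicator e) :=
  measurable_const.indicator (isClopen_basicClopen e).1.measurableSet

/-- As `log 2` is neither `0` nor `∞`, the indicator of `e` is log-integrable exactly when `μ e` is
finite. -/
theorem logIntegral_clopenIndicator (μ : BooleanMeasure B) (e : B) :
    logIntegral μ (clopenIndicator e) = ENNReal.ofReal (Real.log 2) * μ e := by
  rw [← μ.stoneMeasure_basicClopen,
    ← lintegral_indicator_const (isClopen_basicClopen e).1.measurableSet]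
  refine lintegral_congr fun x => ?_
  by_cases hx : x ∈ basicClopen e
  · simp [clopenIndicator, hx, one_add_one_eq_two]
  · simp [clopenIndicator, hx]

/-- The projection in `L_log` of an element of finite measure. -/
def Llog.proj (e : {e : B // μ e < ∞}) : Llog μ :=
  Llog.mk (clopenIndicator e.1) (measurable_clopenIndicator e.1) (by
    rw [logIntegral_clopenIndicator]
    exact ENNReal.mul_lt_top ENNReal.ofReal_lt_top e.2)

/-- Expresses the order of the Boolean algebra by multiplication alone, so that multiplicative maps
respect it. -/
theorem clopenIndicator_mul_eq_iff {a b : B} :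
    clopenIndicator a * clopenIndicator b =ᶠ[residual _] clopenIndicator a ↔ a ≤ b := by
  constructor
  · intro h
    refine le_of_isMeagre_diff ?_
    rw [IsMeagre]
    filter_upwards [h] with x hx hab
    simp [clopenIndicator, hab.1, hab.2] at hx
  · intro h
    refine Eventually.of_forall fun x => ?_
    by_cases hx : x ∈ basicClopen a
    · simp [clopenIndicator, hx, basicClopen_mono h hx]
    · simp [clopenIndicator, hx]

theorem Llog.proj_mul_proj_eq_iff {a b : {e : B // μ e < ∞}} :
    Llog.proj a * Llog.proj b = Llog.proj a ↔ a ≤ b :=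
  germ_injective.eq_iff.symm.trans (Germ.coe_eq.trans clopenIndicator_mul_eq_iff)

theorem Llog.proj_injective : Function.Injective (Llog.proj (μ := μ)) := by
  intro a b h
  refine le_antisymm (proj_mul_proj_eq_iff.1 ?_) (proj_mul_proj_eq_iff.1 ?_)
  · rw [← h]; exact proj_mul_proj_eq_iff.2 le_rfl
  · rw [h]; exact proj_mul_proj_eq_iff.2 le_rfl

/-- Off a meagre set an idempotent function takes only the values `0` and `1`, so it is the
indicator of the clopen set representing `{g = 1}`; self-adjointness is automatic. -/
theorem Llog.exists_proj_eq {p : Llog μ} (hp : p * p = p) : ∃ e, Llog.proj e = p := by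
  obtain ⟨g, hg, h, rfl⟩ := Llog.exists_rep p
  have hgg : g * g =ᶠ[residual _] g := Germ.coe_eq.1 (congrArg Llog.germ hp)
  have hS : MeasurableSet {x | g x = 1} := hg (measurableSet_singleton 1)
  have heq : clopenIndicator (value {x | g x = 1}) =ᶠ[residual _] g := by
    filter_upwards [hgg, (eventuallyEq_value hS).mem_iff] with x hx hx'
    by_cases h1 : g x = 1
    · simp [clopenIndicator, hx'.1 h1, h1]
    · have h0 : g x = 0 := by
        have h2 : g x * g x = g x := hx
        by_contra h0
        exact h1 (mul_left_cancel₀ h0 (by rw [h2, mul_one]))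
      have hn : x ∉ basicClopen (value {x | g x = 1}) := fun hx'' => h1 (hx'.2 hx'')
      simp [clopenIndicator, hn, h0]
  have hfin : μ (value {x | g x = 1}) < ∞ := by
    rw [← logIntegral_congr μ (measurable_clopenIndicator _) hg heq,
      logIntegral_clopenIndicator] at h
    refine (ENNReal.mul_lt_top_iff.1 h).elim And.right fun h => h.elim (fun h => ?_) fun h => ?_
    · exact absurd h (ENNReal.ofReal_pos.2 (Real.log_pos one_lt_two)).ne'
    · simp [h]
  exact ⟨⟨_, hfin⟩, mk_eq_mk.2 heq⟩

end Representatives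

/-! ### Log-equivalent measures have isomorphic algebras -/

section Pullback

variable {B₁ B₂ : Type*} [CompleteBooleanAlgebra B₁] [CompleteBooleanAlgebra B₂]

/-- Composition with the homeomorphism of Stone spaces dual to an isomorphism, as a function. -/
def Llog.pullbackFun (μ : BooleanMeasure B₁) (φ : B₁ ≃o B₂) (f : Llog μ) : Llog (μ.map φ) :=
  ⟨⟨(Llog.germ f).compTendsto _ (tendsto_residual_homeomorph (stoneHomeomorph φ)), by
      obtain ⟨g, hg, h, rfl⟩ := Llog.exists_rep f
      exact ⟨_, hg.comp (stoneHomeomorph φ).continuous.measurable, rfl⟩⟩, by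
      obtain ⟨g, hg, h, rfl⟩ := Llog.exists_rep f
      exact ⟨_, hg.comp (stoneHomeomorph φ).continuous.measurable, rfl, by
        rwa [logIntegral_comp_stoneHomeomorph φ μ hg]⟩⟩

theorem Llog.germ_pullbackFun (μ : BooleanMeasure B₁) (φ : B₁ ≃o B₂) (f : Llog μ) :
    germ (pullbackFun μ φ f) =
      (germ f).compTendsto _ (tendsto_residual_homeomorph (stoneHomeomorph φ)) := rfl

/-- Composition with the homeomorphism of Stone spaces dual to an isomorphism. -/
def Llog.pullback (μ : BooleanMeasure B₁) (φ : B₁ ≃o B₂) : Llog μ →⋆ₙₐ[ℂ] Llog (μ.map φ) where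
  toFun := pullbackFun μ φ
  map_smul' c f := by
    apply germ_injective
    change germ (pullbackFun μ φ (c • f)) = germ (c • pullbackFun μ φ f)
    rw [germ_smul, germ_pullbackFun, germ_pullbackFun, germ_smul]
    induction germ f using Germ.inductionOn
    rfl
  map_zero' := germ_injective rfl
  map_add' f f' := by
    apply germ_injective
    rw [germ_add, germ_pullbackFun, germ_pullbackFun, germ_pullbackFun, germ_add]
    induction germ f using Germ.inductionOn
    induction germ f' using Germ.inductionOn
    rfl
  map_mul' f f' := by
    apply germ_injective
    rw [germ_mul, germ_pullbackFun, germ_pullbackFun, germ_pullbackFun, germ_mul]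
    induction germ f using Germ.inductionOn
    induction germ f' using Germ.inductionOn
    rfl
  map_star' f := by
    apply germ_injective
    rw [germ_star, germ_pullbackFun, germ_pullbackFun, germ_star]
    induction germ f using Germ.inductionOn
    rfl

theorem Llog.pullback_mk (μ : BooleanMeasure B₁) (φ : B₁ ≃o B₂) {g : StoneSpace B₁ → ℂ}
    (hg : Measurable g) (h : logIntegral μ g < ∞) :
    Llog.pullback μ φ (Llog.mk g hg h) =
      Llog.mk (g ∘ stoneHomeomorph φ) (hg.comp (stoneHomeomorph φ).continuous.measurable)
        (by rwa [logIntegral_comp_stoneHomeomorph φ μ hg]) := rfl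

theorem Llog.pullback_bijective (μ : BooleanMeasure B₁) (φ : B₁ ≃o B₂) :
    Function.Bijective (Llog.pullback μ φ) := by
  constructor
  · intro f f' hff
    obtain ⟨g, hg, h, rfl⟩ := Llog.exists_rep f
    obtain ⟨g', hg', h', rfl⟩ := Llog.exists_rep f'
    rw [pullback_mk, pullback_mk, mk_eq_mk] at hff
    rw [mk_eq_mk]
    filter_upwards [(tendsto_residual_homeomorph (stoneHomeomorph φ).symm).eventually hff]
      with x hx
    simpa using hx
  · intro f
    obtain ⟨g, hg, h, rfl⟩ := Llog.exists_rep f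
    have hg' : Measurable (g ∘ (stoneHomeomorph φ).symm) :=
      hg.comp (stoneHomeomorph φ).symm.continuous.measurable
    have hc : (g ∘ (stoneHomeomorph φ).symm) ∘ stoneHomeomorph φ = g := by
      ext x; simp
    refine ⟨Llog.mk (g ∘ (stoneHomeomorph φ).symm) hg' ?_, ?_⟩
    · rwa [← logIntegral_comp_stoneHomeomorph φ μ hg', hc]
    · rw [pullback_mk, mk_eq_mk, hc]

end Pullback

/-! ### Extending isomorphisms from dense lower sets -/

section Extension

variable {B₁ B₂ : Type*} [CompleteBooleanAlgebra B₁] [CompleteBooleanAlgebra B₂]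
  {p : B₁ → Prop} {q : B₂ → Prop}

/-- The supremum of the images of the elements below `b` acquires no further images. By
distributivity it suffices to bound each `φ e ⊓ φ d`; this lies in the lower set, so it is some `φ
c`, and `c ≤ e ⊓ d ≤ e ⊓ b`. -/
theorem le_iSup_map_iff (hp : ∀ a b, a ≤ b → p b → p a) (hq : ∀ a b, a ≤ b → q b → q a)
    (φ : {e // p e} ≃o {e // q e}) (e : {e // p e}) (b : B₁) :
    ((φ e : B₂) ≤ ⨆ d : {d : {e // p e} // d.1 ≤ b}, (φ d.1 : B₂)) ↔ e.1 ≤ b := by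
  constructor
  · intro h
    have hm : p (e.1 ⊓ b) := hp _ _ inf_le_left e.2
    suffices φ e ≤ φ ⟨e.1 ⊓ b, hm⟩ from
      (show e.1 ≤ e.1 ⊓ b from φ.le_iff_le.1 this).trans inf_le_right
    change (φ e : B₂) ≤ φ ⟨e.1 ⊓ b, hm⟩
    rw [← inf_eq_left.2 h, inf_iSup_eq]
    refine iSup_le fun d => ?_
    have hc : q ((φ e : B₂) ⊓ φ d.1) := hq _ _ inf_le_left (φ e).2
    obtain ⟨c, hc'⟩ := φ.surjective ⟨_, hc⟩
    have h1 : c ≤ e := φ.le_iff_le.1 (by rw [hc']; exact Subtype.mk_le_mk.2 inf_le_left)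
    have h2 : c ≤ d.1 := φ.le_iff_le.1 (by rw [hc']; exact Subtype.mk_le_mk.2 inf_le_right)
    have h3 : φ c ≤ φ ⟨e.1 ⊓ b, hm⟩ := φ.monotone (le_inf h1 (le_trans h2 d.2))
    rw [hc'] at h3
    exact h3
  · exact fun h => le_iSup (fun d : {d : {e // p e} // d.1 ≤ b} => (φ d.1 : B₂)) ⟨e, h⟩

/-- By density an element is determined by the members of the lower set below it. The maps `F` and
`G`, given by suprema of images, match these members through `φ`, so they are mutually inverse. -/
theorem exists_orderIso_extension (hp : ∀ a b, a ≤ b → p b → p a)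
    (hq : ∀ a b, a ≤ b → q b → q a)
    (dp : ∀ a b, (∀ e, p e → e ≤ a → e ≤ b) → a ≤ b)
    (dq : ∀ a b, (∀ e, q e → e ≤ a → e ≤ b) → a ≤ b) (φ : {e // p e} ≃o {e // q e}) :
    ∃ ψ : B₁ ≃o B₂, ∀ e, ψ e.1 = φ e := by
  have k1 := le_iSup_map_iff hp hq φ
  have k2 : ∀ (e : {e // p e}) (b : B₂),
      (e.1 ≤ ⨆ d : {d : {e // q e} // d.1 ≤ b}, (φ.symm d.1 : B₁)) ↔ (φ e).1 ≤ b := fun e b => by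
    simpa using le_iSup_map_iff hq hp φ.symm (φ e) b
  let F : B₁ → B₂ := fun b => ⨆ d : {d : {e // p e} // d.1 ≤ b}, (φ d.1 : B₂)
  let G : B₂ → B₁ := fun b => ⨆ d : {d : {e // q e} // d.1 ≤ b}, (φ.symm d.1 : B₁)
  have k1' : ∀ e b, (φ e : B₂) ≤ F b ↔ e.1 ≤ b := k1
  have k2' : ∀ (e : {e // p e}) b, e.1 ≤ G b ↔ (φ e).1 ≤ b := k2
  have hGF : ∀ b, G (F b) = b := fun b => le_antisymm
    (dp _ _ fun e he h => (k1' ⟨e, he⟩ b).1 ((k2' ⟨e, he⟩ _).1 h))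
    (dp _ _ fun e he h => (k2' ⟨e, he⟩ _).2 ((k1' ⟨e, he⟩ b).2 h))
  have hFG : ∀ b, F (G b) = b := by
    have : ∀ (e : {e // q e}) b, e.1 ≤ F (G b) ↔ e.1 ≤ b := fun e b => by
      obtain ⟨e, rfl⟩ := φ.surjective e
      rw [k1', k2']
    exact fun b => le_antisymm (dq _ _ fun e he h => (this ⟨e, he⟩ b).1 h)
      (dq _ _ fun e he h => (this ⟨e, he⟩ b).2 h)
  refine ⟨⟨⟨F, G, hGF, hFG⟩, ?_⟩, fun e => ?_⟩
  · intro a b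
    change F a ≤ F b ↔ a ≤ b
    refine ⟨fun h => dp _ _ fun e he hea => ?_, fun h => ?_⟩
    · exact (k1' ⟨e, he⟩ b).1 (((k1' ⟨e, he⟩ a).2 hea).trans h)
    · exact iSup_le fun d => (k1' d.1 b).2 (d.2.trans h)
  · exact le_antisymm (iSup_le fun d => φ.monotone d.2) ((k1' e e.1).2 le_rfl)

/-- Density of the elements of finite measure: σ-finiteness cuts `a` into countably many of them. -/
theorem BooleanMeasure.le_of_forall_lt_top {B : Type*} [CompleteBooleanAlgebra B]
    (μ : BooleanMeasure B) (a b : B) (h : ∀ e, μ e < ∞ → e ≤ a → e ≤ b) : a ≤ b := by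
  obtain ⟨s, hs, hfin⟩ := μ.sigma_finite
  rw [← inf_top_eq a, ← hs, inf_iSup_eq]
  exact iSup_le fun n => h _ ((μ.mono inf_le_right).trans_lt (hfin n)) inf_le_left

end Extension

/-! ### Isomorphisms of the algebras are spatial -/

section Spatial

variable {B₁ B₂ : Type*} [CompleteBooleanAlgebra B₁] [CompleteBooleanAlgebra B₂]
  {μ : BooleanMeasure B₁} {ν : BooleanMeasure B₂}

theorem exists_orderIso_map_proj (Φ : Llog μ ≃⋆ₐ[ℂ] Llog ν) :
    ∃ φ : {e // μ e < ∞} ≃o {e // ν e < ∞}, ∀ e, Φ (Llog.proj e) = Llog.proj (φ e) := by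
  have h1 : ∀ e : {e // μ e < ∞}, ∃ d : {e // ν e < ∞}, Llog.proj d = Φ (Llog.proj e) :=
    fun e => Llog.exists_proj_eq (by rw [← map_mul, Llog.proj_mul_proj_eq_iff.2 le_rfl])
  choose F hF using h1
  have hle : ∀ a b, F a ≤ F b ↔ a ≤ b := fun a b => by
    rw [← Llog.proj_mul_proj_eq_iff, hF, hF, ← map_mul, (EquivLike.injective Φ).eq_iff,
      Llog.proj_mul_proj_eq_iff]
  have hsurj : Function.Surjective F := fun d => by
    obtain ⟨e, he⟩ := Llog.exists_proj_eq (p := Φ.symm (Llog.proj d))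
      (by rw [← map_mul, Llog.proj_mul_proj_eq_iff.2 le_rfl])
    exact ⟨e, Llog.proj_injective (by rw [hF, he, StarAlgEquiv.apply_symm_apply])⟩
  let E : {e // μ e < ∞} ↪o {e // ν e < ∞} := OrderEmbedding.ofMapLEIff F hle
  exact ⟨RelIso.ofSurjective E hsurj, fun e => (hF e).symm⟩

/-- With `u = (g - c)` cut to `d` and `w = √(ε² - |g - c|²)` cut to `d`, the bound becomes `star u *
u + star w * w = ε² • proj d`. Applying `Φ` and dropping the nonnegative term coming from `w` bounds
`k - c` on `d'`. -/
theorem norm_sub_le_of_map_proj (Φ : Llog μ ≃⋆ₐ[ℂ] Llog ν) {d : {e // μ e < ∞}}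
    {d' : {e // ν e < ∞}} (hd : Φ (Llog.proj d) = Llog.proj d')
    {g : StoneSpace B₁ → ℂ} {hg : Measurable g} {hgi : logIntegral μ g < ∞}
    {k : StoneSpace B₂ → ℂ} {hk : Measurable k} {hki : logIntegral ν k < ∞}
    (hgk : Φ (Llog.mk g hg hgi) = Llog.mk k hk hki) {c : ℂ} {ε : ℝ} (hε : 0 ≤ ε)
    (h : ∀ᶠ x in residual _, x ∈ basicClopen d.1 → ‖g x - c‖ ≤ ε) :
    ∀ᶠ y in residual _, y ∈ basicClopen d'.1 → ‖k y - c‖ ≤ ε := by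
  -- Where `‖g x - c‖ > ε` the real square root is `0`, so `r` is bounded by `ε` everywhere.
  let r : StoneSpace B₁ → ℂ := fun x => (√(ε ^ 2 - ‖g x - c‖ ^ 2) : ℝ)
  have hr : Measurable r := Complex.measurable_ofReal.comp
    (measurable_const.sub ((hg.sub measurable_const).norm.pow_const 2)).sqrt
  have hrb : ∀ x, ‖r x‖ ≤ ε := fun x => by
    simp only [r, Complex.norm_real, Real.norm_eq_abs, abs_of_nonneg (Real.sqrt_nonneg _)]
    exact Real.sqrt_le_iff.2 ⟨hε, by linarith [sq_nonneg ‖g x - c‖]⟩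
  let w : Llog μ := Llog.mk ((basicClopen d.1).indicator r)
    (hr.indicator (isClopen_basicClopen d.1).1.measurableSet)
    (logIntegral_indicator_lt_top d.2 hrb)
  -- The constant is subtracted as a multiple of the projection, since `Llog μ` may have no unit.
  let u : Llog μ := Llog.mk g hg hgi * Llog.proj d + (-c) • Llog.proj d
  have key : star u * u + star w * w = ((ε ^ 2 : ℝ) : ℂ) • Llog.proj d := by
    refine Llog.germ_injective (Germ.coe_eq.2 (?_ : (fun x =>
      star (g x * clopenIndicator d.1 x + -c * clopenIndicator d.1 x) *
        (g x * clopenIndicator d.1 x + -c * clopenIndicator d.1 x) +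
      star ((basicClopen d.1).indicator r x) * (basicClopen d.1).indicator r x)
      =ᶠ[residual _] fun x => ((ε ^ 2 : ℝ) : ℂ) * clopenIndicator d.1 x))
    filter_upwards [h] with x hx
    by_cases hxd : x ∈ basicClopen d.1
    · have h2 : 0 ≤ ε ^ 2 - ‖g x - c‖ ^ 2 := by
        have := hx hxd
        nlinarith [norm_nonneg (g x - c)]
      simp only [clopenIndicator, indicator_of_mem hxd, mul_one, ← sub_eq_add_neg, RCLike.star_def,
        Complex.conj_mul', r, Complex.norm_real, Real.norm_eq_abs]
      norm_cast
      rw [sq_abs, Real.sq_sqrt h2]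
      ring
    · simp [clopenIndicator, hxd]
  have key' := congrArg Φ key
  obtain ⟨t, ht, hti, htw⟩ := Llog.exists_rep (Φ w)
  simp only [u, map_add, map_mul, map_star, map_smul, hd, hgk, htw] at key'
  have ev : (fun y => star (k y * clopenIndicator d'.1 y + -c * clopenIndicator d'.1 y) *
        (k y * clopenIndicator d'.1 y + -c * clopenIndicator d'.1 y) + star (t y) * t y)
      =ᶠ[residual _] fun y => ((ε ^ 2 : ℝ) : ℂ) * clopenIndicator d'.1 y :=
    Germ.coe_eq.1 (congrArg Llog.germ key')
  filter_upwards [ev] with y hy hyd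
  simp only [clopenIndicator, indicator_of_mem hyd, mul_one, ← sub_eq_add_neg, RCLike.star_def,
    Complex.conj_mul'] at hy
  norm_cast at hy
  exact le_of_sq_le_sq (by linarith [sq_nonneg ‖t y‖]) hε

theorem map_mk_eventuallyEq (Φ : Llog μ ≃⋆ₐ[ℂ] Llog ν) {φ : B₁ ≃o B₂}
    (hfin : ∀ e, μ e < ∞ → ν (φ e) < ∞)
    (hφ : ∀ (e) (he : μ e < ∞), Φ (Llog.proj ⟨e, he⟩) = Llog.proj ⟨φ e, hfin e he⟩)
    {g : StoneSpace B₁ → ℂ} {hg : Measurable g} {hgi : logIntegral μ g < ∞}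
    {k : StoneSpace B₂ → ℂ} {hk : Measurable k} {hki : logIntegral ν k < ∞}
    (hgk : Φ (Llog.mk g hg hgi) = Llog.mk k hk hki) :
    k =ᶠ[residual _] g ∘ stoneHomeomorph φ := by
  obtain ⟨s, hs, hsfin⟩ := μ.sigma_finite
  -- The union of the clopen sets of the `s m` is open and dense but need not be the whole space.
  have hcover : ∀ᶠ x in residual (StoneSpace B₁), ∃ m, x ∈ basicClopen (s m) := by
    have h := (closure_residualEq (isOpen_iUnion fun n =>
      (isClopen_basicClopen (s n)).2).isLocallyClosed).mem_iff
    rw [← basicClopen_iSup, hs, basicClopen_top] at h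
    filter_upwards [h] with x hx
    simpa using hx
  let S : ℕ → ℕ → Set (StoneSpace B₁) := fun i n => {x | ‖g x - TopologicalSpace.denseSeq ℂ i‖ ≤ 1 / (n + 1 : ℝ)}
  have hS : ∀ i n, MeasurableSet (S i n) := fun i n =>
    measurableSet_le (hg.sub measurable_const).norm measurable_const
  have hval : ∀ i n, ∀ᶠ x in residual _, x ∈ S i n ↔ x ∈ basicClopen (value (S i n)) :=
    fun i n => (eventuallyEq_value (hS i n)).mem_iff
  -- Meeting with `s m` makes the measure finite, so a projection is available. The index set is
  -- countable, so one residual set serves all the bounds.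
  have main : ∀ m i n, ∀ᶠ y in residual _, y ∈ basicClopen (φ (s m ⊓ value (S i n))) →
      ‖k y - TopologicalSpace.denseSeq ℂ i‖ ≤ 1 / (n + 1 : ℝ) := by
    intro m i n
    refine norm_sub_le_of_map_proj Φ
      (hφ _ ((μ.mono (inf_le_left : s m ⊓ value (S i n) ≤ _)).trans_lt (hsfin m))) hgk
      (by positivity) ?_
    filter_upwards [hval i n] with x hx hxd
    rw [basicClopen_inf] at hxd
    exact hx.2 hxd.2
  have ht := tendsto_residual_homeomorph (stoneHomeomorph φ)
  filter_upwards [ht.eventually hcover,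
    eventually_countable_forall.2 fun i => eventually_countable_forall.2 fun n =>
      ht.eventually (hval i n),
    eventually_countable_forall.2 fun m => eventually_countable_forall.2 fun i =>
      eventually_countable_forall.2 fun n => main m i n] with y hy1 hy2 hy3
  obtain ⟨m, hm⟩ := hy1
  refine eq_of_forall_dist_le fun ε hε => ?_
  -- Both values lie within `1 / (n + 1) < ε / 2` of one point of the dense sequence.
  obtain ⟨n, hn⟩ := exists_nat_one_div_lt (half_pos hε)
  obtain ⟨i, hi⟩ := (TopologicalSpace.denseRange_denseSeq ℂ).exists_dist_lt (g (stoneHomeomorph φ y))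
    (show (0 : ℝ) < 1 / (n + 1 : ℝ) by positivity)
  have h1 : ‖g (stoneHomeomorph φ y) - TopologicalSpace.denseSeq ℂ i‖ ≤ 1 / (n + 1 : ℝ) := by
    rw [← dist_eq_norm]; exact hi.le
  have h2 : ‖k y - TopologicalSpace.denseSeq ℂ i‖ ≤ 1 / (n + 1 : ℝ) := by
    refine hy3 m i n ?_
    rw [← stoneHomeomorph_mem_basicClopen, basicClopen_inf]
    exact ⟨hm, (hy2 i n).1 h1⟩
  rw [← dist_eq_norm] at h1 h2
  have := dist_triangle_right (k y) (g (stoneHomeomorph φ y)) (TopologicalSpace.denseSeq ℂ i)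
  simp only [Function.comp]
  linarith

theorem logEquivalent_of_starAlgEquiv (Φ : Llog μ ≃⋆ₐ[ℂ] Llog ν) : LogEquivalent μ ν := by
  obtain ⟨φ₀, hφ₀⟩ := exists_orderIso_map_proj Φ
  obtain ⟨φ, hφ⟩ := exists_orderIso_extension
    (fun a b hab hb => (μ.mono hab).trans_lt hb) (fun a b hab hb => (ν.mono hab).trans_lt hb)
    μ.le_of_forall_lt_top ν.le_of_forall_lt_top φ₀
  have hfin : ∀ e, μ e < ∞ → ν (φ e) < ∞ := fun e he => by
    rw [hφ ⟨e, he⟩]; exact (φ₀ ⟨e, he⟩).2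
  have hproj : ∀ (e) (he : μ e < ∞), Φ (Llog.proj ⟨e, he⟩) = Llog.proj ⟨φ e, hfin e he⟩ :=
    fun e he => (hφ₀ ⟨e, he⟩).trans (congrArg Llog.proj (Subtype.ext (hφ ⟨e, he⟩).symm))
  refine ⟨φ, ?_⟩
  ext ⟨f, hf⟩
  obtain ⟨g', hg', rfl⟩ := id hf
  rw [mem_Llog_coe hg', mem_Llog_coe hg']
  constructor
  -- Surjectivity of `Φ`: the function is the image of some `g` in `Llog μ`, hence agrees with `g ∘
  -- stoneHomeomorph φ`.
  · intro h
    obtain ⟨g, hg, hgi, hgΦ⟩ := Llog.exists_rep (Φ.symm (Llog.mk g' hg' h))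
    have hgk : Φ (Llog.mk g hg hgi) = Llog.mk g' hg' h := by
      rw [← hgΦ, StarAlgEquiv.apply_symm_apply]
    rwa [logIntegral_congr _ hg' (hg.comp (stoneHomeomorph φ).continuous.measurable)
      (map_mk_eventuallyEq Φ hfin hproj hgk), logIntegral_comp_stoneHomeomorph φ μ hg]
  -- `Φ` is defined on all of `Llog μ`: the function transported back lies there, and its image in
  -- `Llog ν` is the original function.
  · intro h
    have hg : Measurable (g' ∘ (stoneHomeomorph φ).symm) :=
      hg'.comp (stoneHomeomorph φ).symm.continuous.measurable
    have hc : (g' ∘ (stoneHomeomorph φ).symm) ∘ stoneHomeomorph φ = g' := by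
      ext x; simp
    have hgi : logIntegral μ (g' ∘ (stoneHomeomorph φ).symm) < ∞ := by
      rwa [← logIntegral_comp_stoneHomeomorph φ μ hg, hc]
    obtain ⟨k, hk, hki, hgk⟩ := Llog.exists_rep (Φ (Llog.mk _ hg hgi))
    have := map_mk_eventuallyEq Φ hfin hproj hgk
    rw [hc] at this
    rwa [← logIntegral_congr _ hk hg' this]

theorem LogEquivalent.nonempty_starAlgEquiv (h : LogEquivalent μ ν) :
    Nonempty (Llog μ ≃⋆ₐ[ℂ] Llog ν) := by
  obtain ⟨φ, hφ⟩ := h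
  rw [hφ]
  exact ⟨StarAlgEquiv.ofBijective (Llog.pullback μ φ) (Llog.pullback_bijective μ φ)⟩

end Spatial

end LogAlgebra

end

theorem theorem1 {B₁ B₂ : Type*} [CompleteBooleanAlgebra B₁] [CompleteBooleanAlgebra B₂]
    (μ : LogAlgebra.BooleanMeasure B₁) (ν : LogAlgebra.BooleanMeasure B₂) :
    Nonempty (LogAlgebra.Llog μ ≃⋆ₐ[ℂ] LogAlgebra.Llog ν) ↔ LogAlgebra.LogEquivalent μ ν :=
  ⟨fun ⟨Φ⟩ => LogAlgebra.logEquivalent_of_starAlgEquiv Φ, fun h => h.nonempty_starAlgEquiv⟩
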